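/- Let $d$ be a natural number, let $X \subset \mathbb{R}^d$ be a finite set of unit vectors, and let $\mu$ be a probability distribution over $X$ (so $\mu(x) \ge 0$ for $x \in X$ and $\sum_{x \in X} \mu(x) = 1$; in particular $d \ge 1$). For a subspace $V \subseteq \mathbb{R}^d$ write $\mu(X\cap V) = \sum_{x \in X \cap V} \mu(x)$. A finite set $Y$ of unit vectors in a $k$-dimensional Euclidean space $V$, with a probability distribution $\nu$ over $Y$, is said to be in $\varepsilon$-isotropic position (in $V$) if for every nonzero $v \in V$ \[ (1-\varepsilon)\frac1k \;\le\; \sum_{y \in Y} \nu(y) \frac{\langle y, v\rangle^2}{\|v\|^2} \;\le\; (1+\varepsilon)\frac1k . \] For an invertible linear map $T : V \to V$, the transformed pair $(Y_T, \nu_T)$ is given by \[ Y_T = \left\{ y_T = \frac{T(y)}{\|T(y)\|} : y \in Y \right\}, \qquad \nu_T(y_T) = \nu(y). \] Then there exist an integer $1 \le k \le d$ and a $k$-dimensional subspace $V \subseteq \mathbb{R}^d$ such that \begin{enumerate} \item $\mu(X \cap V) \ge \frac{k}{d}$, and \item for every $\varepsilon > 0$ there is an invertible linear transformation $T : V \to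 V$ such that the pair $((X \cap V)_T, (\mu|_{X\cap V})_T)$ is in $\varepsilon$-isotropic position in $V$, where $\mu|_{X \cap V}(x) = \mu(x)/\mu(X \cap V)$ is the normalized restriction of $\mu$ to $X \cap V$. \end{enumerate} -/

import Mathlib

/-- A pair `(X, μ)`: a finite set `X` of unit vectors of a Euclidean space `E` together with a
probability distribution `μ` over `X`, given by its point masses. Only the values of `mass` on
`points` carry information. -/
structure UnitPair (E : Type*) [NormedAddCommGroup E] where
  points : Finset E
  mass : E → ℝ
  norm_eq_one : ∀ x ∈ points, ‖x‖ = 1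
  mass_nonneg : ∀ x ∈ points, 0 ≤ mass x
  sum_mass : ∑ x ∈ points, mass x = 1

namespace UnitPair

variable {E : Type*} [NormedAddCommGroup E] [InnerProductSpace ℝ E]

open Classical in
/-- The fraction `μ(X ∩ V)` of the pair that lies in the subspace `V`. -/
noncomputable def massIn (P : UnitPair E) (V : Submodule ℝ E) : ℝ :=
  ∑ x ∈ P.points with x ∈ V, P.mass x

open Classical in
/-- The pair `(X ∩ V, μ|_{X ∩ V})` in the Euclidean space `V`, where `μ|_{X ∩ V}` is the normalized
restriction `x ↦ μ(x) / μ(X ∩ V)`. -/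
noncomputable def restrict (P : UnitPair E) (V : Submodule ℝ E) (hV : 0 < P.massIn V) :
    UnitPair V where
  points := P.points.subtype (fun x => x ∈ V)
  mass := fun x => P.mass (x : E) / P.massIn V
  norm_eq_one := fun x hx => P.norm_eq_one (x : E) (Finset.mem_subtype.mp hx)
  mass_nonneg := fun x hx =>
    div_nonneg (P.mass_nonneg (x : E) (Finset.mem_subtype.mp hx)) hV.le
  sum_mass := by
    have h : ∑ x ∈ P.points.subtype (fun x => x ∈ V), P.mass (x : E) = P.massIn V :=
      Finset.sum_subtype_eq_sum_filter (s := P.points) (p := fun x => x ∈ V) P.mass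
    rw [← Finset.sum_div, h, div_self hV.ne']

/-- The normalized image `x_T = T x / ‖T x‖`. -/
noncomputable def normalizedImage (T : E ≃ₗ[ℝ] E) (x : E) : E := ‖T x‖⁻¹ • T x

open Classical in
/-- The transformed pair `(X_T, μ_T)`: the set `X_T = {x_T : x ∈ X}` with the image distribution
(`μ_T(x_T) = μ(x)`, see `transform_mass_normalizedImage`). -/
noncomputable def transform (P : UnitPair E) (T : E ≃ₗ[ℝ] E) : UnitPair E where
  points := P.points.image (normalizedImage T)
  mass := fun y => ∑ x ∈ P.points with normalizedImage T x = y, P.mass x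
  norm_eq_one := by
    intro y hy
    obtain ⟨x, hx, rfl⟩ := Finset.mem_image.mp hy
    have hx0 : x ≠ 0 := by
      rintro rfl
      simpa using P.norm_eq_one 0 hx
    have hT : ‖T x‖ ≠ 0 := by simpa using hx0
    rw [normalizedImage, norm_smul, norm_inv, norm_norm, inv_mul_cancel₀ hT]
  mass_nonneg := fun y _ =>
    Finset.sum_nonneg fun x hx => P.mass_nonneg x (Finset.mem_filter.mp hx).1
  sum_mass := by
    rw [← P.sum_mass]
    exact Finset.sum_fiberwise_of_maps_to
      (fun x hx => Finset.mem_image_of_mem (normalizedImage T) hx) P.mass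

/-- Distinct unit vectors have distinct normalized images. -/
theorem normalizedImage_injOn (P : UnitPair E) (T : E ≃ₗ[ℝ] E) :
    Set.InjOn (normalizedImage T) (P.points : Set E) := by
  intro x hx y hy hxy
  have hx1 := P.norm_eq_one x hx
  have hy1 := P.norm_eq_one y hy
  have hx0 : x ≠ 0 := by
    rintro rfl
    simp at hx1
  have hTx : ‖T x‖ ≠ 0 := by simpa using hx0
  have h : ‖T x‖⁻¹ • x = ‖T y‖⁻¹ • y := by
    apply T.injective
    simpa [normalizedImage] using hxy
  have hn : ‖T x‖⁻¹ = ‖T y‖⁻¹ := by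
    have := congrArg norm h
    simpa [norm_smul, hx1, hy1] using this
  rw [← hn] at h
  exact smul_right_injective E (inv_ne_zero hTx) h

theorem transform_mass_normalizedImage (P : UnitPair E) (T : E ≃ₗ[ℝ] E) {x : E}
    (hx : x ∈ P.points) : (P.transform T).mass (normalizedImage T x) = P.mass x := by
  classical
  have h : (P.points.filter fun z => normalizedImage T z = normalizedImage T x) = {x} := by
    ext z
    simp only [Finset.mem_filter, Finset.mem_singleton]
    constructor
    · rintro ⟨hz, hzx⟩
      exact P.normalizedImage_injOn T hz hx hzx
    · rintro rfl
      exact ⟨hx, rfl⟩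
  have h' : (P.transform T).mass (normalizedImage T x) =
      ∑ z ∈ P.points.filter (fun z => normalizedImage T z = normalizedImage T x), P.mass z := by
    simp only [transform]
  rw [h', h, Finset.sum_singleton]

/-- `ε`-isotropic position, where the dimension is that of the space `E` containing the pair. -/
def IsIsotropic (P : UnitPair E) (ε : ℝ) : Prop :=
  ∀ v : E, v ≠ 0 →
    (1 - ε) * (1 / (Module.finrank ℝ E : ℝ)) ≤ ∑ x ∈ P.points, P.mass x * (inner ℝ x v ^ 2 / ‖v‖ ^ 2) ∧
    ∑ x ∈ P.points, P.mass x * (inner ℝ x v ^ 2 / ‖v‖ ^ 2) ≤ (1 + ε) * (1 / (Module.finrank ℝ E : ℝ))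

end UnitPair

/-! Take V of least positive dimension k with μ(X ∩ V) ≥ k/d. Minimality makes the normalized
restriction ν satisfy k·ν(W) ≤ dim W for all W ≤ V. On V consider Φ(T) = ∑ k ν(x) log ‖T x‖ − log
|det T|. The rank condition puts the weights k ν in the matroid base polytope, so the greedy
algorithm gives a basis B with ∑_B log ‖T x‖ at most the weighted sum (`exists_basis_sum_le`). A
Hadamard bound on B then bounds Φ below (`bddBelow_potential`). If isotropy fails at T in direction
v, stretching or shrinking along v lowers Φ by a fixed c > 0 (`exists_potential_le`,
`exists_stretch_gain`). Hence any T within c of inf Φ works; no minimizer is needed. -/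

/-- Greedy choice of a basis of the span of `X`: if a weighting `m` on `X` is dominated by the
rank, then some basis contained in `X` has `w`-gap below every upper bound `t` of `w` at least as
large as the `m`-weighted gap. -/
theorem exists_basis_sum_gap_ge {E : Type*} [AddCommGroup E] [Module ℝ E]
    (X : Finset E) (w m : E → ℝ)
    (hm : ∀ S ⊆ X, ∑ x ∈ S, m x ≤ Module.finrank ℝ (Submodule.span ℝ (S : Set E))) :
    ∃ B ⊆ X, LinearIndepOn ℝ id (B : Set E) ∧
      Submodule.span ℝ (B : Set E) = Submodule.span ℝ (X : Set E) ∧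
      ∀ t, (∀ x ∈ X, w x ≤ t) → ∑ x ∈ X, m x * (t - w x) ≤ ∑ x ∈ B, (t - w x) := by
  classical
  -- Elements enter in increasing order of `w`, as in Kruskal's algorithm.
  induction X using Finset.induction_on_max_value w with
  | empty => exact ⟨∅, by simp, by simp, by simp, by simp⟩
  | insert a X haX hmax ih =>
    obtain ⟨B, hBX, hind, hspan, hgap⟩ := ih fun S hS => hm S (hS.trans (Finset.subset_insert a X))
    have key : ∃ B' ⊆ insert a X, LinearIndepOn ℝ id (B' : Set E) ∧
        Submodule.span ℝ (B' : Set E) = Submodule.span ℝ ((insert a X : Finset E) : Set E) ∧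
        ∑ x ∈ B', (w a - w x) = ∑ x ∈ B, (w a - w x) := by
      by_cases ha : a ∈ Submodule.span ℝ (B : Set E)
      · refine ⟨B, hBX.trans (Finset.subset_insert a X), hind, ?_, rfl⟩
        rw [Finset.coe_insert, Submodule.span_insert, ← hspan]
        exact (sup_eq_right.mpr ((Submodule.span_singleton_le_iff_mem _ _).mpr ha)).symm
      · have haB : a ∉ B := fun h => haX (hBX h)
        refine ⟨insert a B, Finset.insert_subset_insert a hBX, ?_, ?_, ?_⟩
        · rw [Finset.coe_insert]
          exact hind.id_insert ha
        · rw [Finset.coe_insert, Finset.coe_insert, Submodule.span_insert, Submodule.span_insert,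
            hspan]
        · rw [Finset.sum_insert haB]
          ring
    obtain ⟨B', hB'X, hind', hspan', hsum⟩ := key
    refine ⟨B', hB'X, hind', hspan', fun t ht => ?_⟩
    have hcard : ∑ x ∈ insert a X, m x ≤ (B'.card : ℝ) := by
      have := hm _ (Finset.Subset.refl (insert a X))
      rwa [← hspan', finrank_span_finset_eq_card hind'] at this
    have hta : 0 ≤ t - w a := sub_nonneg.mpr (ht a (Finset.mem_insert_self a X))
    -- Raising the threshold from `w a` to `t` adds total mass times `t - w a` on one side and rank
    -- times `t - w a` on the other. At threshold `w a` the new element has zero gap.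
    have h1 : ∑ x ∈ insert a X, m x * (t - w x) =
        ∑ x ∈ X, m x * (w a - w x) + (∑ x ∈ insert a X, m x) * (t - w a) := by
      have h : ∑ x ∈ insert a X, m x * (w a - w x) = ∑ x ∈ X, m x * (w a - w x) := by
        rw [Finset.sum_insert haX]
        ring
      rw [← h, Finset.sum_mul, ← Finset.sum_add_distrib]
      exact Finset.sum_congr rfl fun x _ => by ring
    have h2 : ∑ x ∈ B', (t - w x) = ∑ x ∈ B, (w a - w x) + B'.card * (t - w a) := by
      rw [← hsum, ← nsmul_eq_mul, ← Finset.sum_const, ← Finset.sum_add_distrib]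
      exact Finset.sum_congr rfl fun x _ => by ring
    rw [h1, h2]
    exact add_le_add (hgap (w a) hmax) (mul_le_mul_of_nonneg_right hcard hta)

/-- If a weighting on a finite set is dominated by the rank and has total mass the dimension, then
the weighted sum of any `w` is at least the sum of `w` over some basis. -/
theorem exists_basis_sum_le {E : Type*} [AddCommGroup E] [Module ℝ E] [FiniteDimensional ℝ E]
    (X : Finset E) (w m : E → ℝ)
    (hm : ∀ S ⊆ X, ∑ x ∈ S, m x ≤ Module.finrank ℝ (Submodule.span ℝ (S : Set E)))
    (htot : ∑ x ∈ X, m x = Module.finrank ℝ E) :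
    ∃ B ⊆ X, LinearIndepOn ℝ id (B : Set E) ∧ Submodule.span ℝ (B : Set E) = ⊤ ∧
      ∑ x ∈ B, w x ≤ ∑ x ∈ X, m x * w x := by
  obtain ⟨B, hBX, hind, hspan, hgap⟩ := exists_basis_sum_gap_ge X w m hm
  have htop : Submodule.span ℝ (B : Set E) = ⊤ := by
    rw [hspan]
    apply Submodule.eq_top_of_finrank_eq
    apply le_antisymm (Submodule.finrank_le _)
    have := hm X (Finset.Subset.refl X)
    rw [htot] at this
    exact_mod_cast this
  refine ⟨B, hBX, hind, htop, ?_⟩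
  -- Any upper bound serves: both totals equal the dimension, so `t` cancels.
  obtain ⟨t, ht⟩ := (X.image w).exists_le
  have h := hgap t fun x hx => ht _ (Finset.mem_image_of_mem w hx)
  have hcard : (B.card : ℝ) = Module.finrank ℝ E := by
    rw [← finrank_span_finset_eq_card hind, htop, finrank_top]
  simp only [mul_sub, Finset.sum_sub_distrib, ← Finset.sum_mul, htot, Finset.sum_const,
    nsmul_eq_mul, hcard] at h
  linarith

/-- A Hadamard-type bound: the determinant of an invertible map is controlled by the norms of the
images of the members of a basis. -/
theorem exists_log_abs_det_le {E : Type*} [NormedAddCommGroup E] [InnerProductSpace ℝ E]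
    [FiniteDimensional ℝ E] (B : Finset E) (hind : LinearIndepOn ℝ id (B : Set E))
    (hspan : Submodule.span ℝ (B : Set E) = ⊤) :
    ∃ C : ℝ, ∀ T : E ≃ₗ[ℝ] E,
      Real.log |LinearMap.det (T : E →ₗ[ℝ] E)| ≤ C + ∑ x ∈ B, Real.log ‖T x‖ := by
  classical
  let b : Module.Basis B ℝ E := Module.Basis.mk (v := fun x : B => (x : E)) hind (by
    simpa using hspan.ge)
  have hb : ∀ x, b x = (x : E) := fun x => Module.Basis.mk_apply _ _ x
  have hcont : Continuous b.det.toMultilinearMap := by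
    have : (fun v => b.det.toMultilinearMap v) = fun v : B → E => (b.toMatrix v).det := rfl
    change Continuous fun v => b.det.toMultilinearMap v
    rw [this]
    refine Continuous.matrix_det (continuous_matrix fun i j => ?_)
    exact (b.coord i).continuous_of_finiteDimensional.comp (continuous_apply j)
  obtain ⟨C, hC, hbound⟩ := b.det.toMultilinearMap.exists_bound_of_continuous hcont
  refine ⟨Real.log C, fun T => ?_⟩
  have h := hbound (T ∘ b)
  have hdet : b.det.toMultilinearMap (T ∘ b) = LinearMap.det (T : E →ₗ[ℝ] E) := by
    have := b.det_comp (T : E →ₗ[ℝ] E) b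
    rw [b.det_self, mul_one] at this
    exact this
  rw [hdet, Real.norm_eq_abs] at h
  have hT : ∀ x : B, ‖T (b x)‖ ≠ 0 := fun x => by simpa using b.ne_zero x
  have hpos : 0 < |LinearMap.det (T : E →ₗ[ℝ] E)| :=
    abs_pos.mpr (LinearEquiv.isUnit_det' T).ne_zero
  have h' := Real.log_le_log hpos h
  simp only [Function.comp_apply] at h'
  rw [Real.log_mul hC.ne' (Finset.prod_ne_zero_iff.mpr fun x _ => hT x),
    Real.log_prod fun x _ => hT x] at h'
  refine h'.trans_eq ?_
  rw [← Finset.sum_coe_sort B]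
  simp [hb]

/-- Stretching by the factor `1 + a` along the unit vector `v`. -/
theorem exists_stretch {E : Type*} [NormedAddCommGroup E] [InnerProductSpace ℝ E]
    [FiniteDimensional ℝ E] (v : E) (hv : ‖v‖ = 1) (a : ℝ) (ha : -1 < a) :
    ∃ A : E ≃ₗ[ℝ] E, LinearMap.det (A : E →ₗ[ℝ] E) = 1 + a ∧
      ∀ y, ‖A y‖ ^ 2 = ‖y‖ ^ 2 + (2 * a + a ^ 2) * inner ℝ y v ^ 2 := by
  let f : E →ₗ[ℝ] E := LinearMap.transvection (a • innerₛₗ ℝ v) v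
  have hdet : LinearMap.det f = 1 + a := by
    rw [LinearMap.transvection.det]
    simp [hv]
  refine ⟨f.equivOfDetNeZero (by rw [hdet]; linarith), ?_, fun y => ?_⟩
  · exact hdet
  · change ‖y + (a * inner ℝ v y) • v‖ ^ 2 = _
    rw [norm_add_sq_real, norm_smul, inner_smul_right, hv, real_inner_comm, Real.norm_eq_abs,
      mul_one, sq_abs]
    ring

/-- The gain of a stretch: for small `ε` there are stretch factors which strictly decrease the
potential by a fixed amount. -/
theorem exists_stretch_gain (ε : ℝ) (h0 : 0 < ε) (h1 : ε < 1) :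
    ∃ c : ℝ, 0 < c ∧ ∀ q : ℝ, (q < 1 - ε ∨ 1 + ε < q) →
      ∃ a : ℝ, -1 < a ∧ (2 * a + a ^ 2) / 2 * q - Real.log (1 + a) ≤ -c := by
  -- Gains of `a = ε / 2` and `a = -ε / 4` at the endpoints `q = 1 - ε` and `q = 1 + ε`, the worst
  -- cases.
  obtain ⟨c₁, hc₁⟩ : ∃ c₁, c₁ = Real.log (1 + ε / 2) - (ε + ε ^ 2 / 4) / 2 * (1 - ε) := ⟨_, rfl⟩
  obtain ⟨c₂, hc₂⟩ : ∃ c₂, c₂ = Real.log (1 - ε / 4) + (ε / 2 - ε ^ 2 / 16) / 2 * (1 + ε) :=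
    ⟨_, rfl⟩
  have p₁ : 0 < c₁ := by
    have h := Real.one_sub_inv_le_log_of_pos (show 0 < 1 + ε / 2 by linarith)
    have : (ε + ε ^ 2 / 4) / 2 * (1 - ε) < 1 - (1 + ε / 2)⁻¹ := by
      rw [lt_sub_iff_add_lt, ← lt_sub_iff_add_lt', inv_lt_iff_one_lt_mul₀ (by linarith)]
      nlinarith [mul_pos h0 h0, mul_pos (mul_pos h0 h0) h0, mul_pos (mul_pos h0 h0) (mul_pos h0 h0)]
    linarith
  have p₂ : 0 < c₂ := by
    have h := Real.one_sub_inv_le_log_of_pos (show 0 < 1 - ε / 4 by linarith)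
    have : (1 - ε / 4)⁻¹ < 1 + (ε / 2 - ε ^ 2 / 16) / 2 * (1 + ε) := by
      rw [inv_lt_iff_one_lt_mul₀ (by linarith)]
      nlinarith [mul_pos h0 h0, mul_pos (mul_pos h0 h0) (sub_pos.mpr h1),
        mul_pos h0 (sub_pos.mpr h1), mul_pos (mul_pos h0 h0) h0]
    linarith
  refine ⟨min c₁ c₂, lt_min p₁ p₂, fun q hq => ?_⟩
  rcases hq with hq | hq
  · refine ⟨ε / 2, by linarith, ?_⟩
    have : (ε + ε ^ 2 / 4) / 2 * q ≤ (ε + ε ^ 2 / 4) / 2 * (1 - ε) :=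
      mul_le_mul_of_nonneg_left hq.le (by positivity)
    have h2 := min_le_left c₁ c₂
    have h3 : (2 * (ε / 2) + (ε / 2) ^ 2) / 2 * q = (ε + ε ^ 2 / 4) / 2 * q := by ring
    linarith
  · refine ⟨-(ε / 4), by linarith, ?_⟩
    have : (ε / 2 - ε ^ 2 / 16) / 2 * (1 + ε) ≤ (ε / 2 - ε ^ 2 / 16) / 2 * q :=
      mul_le_mul_of_nonneg_left hq.le (by nlinarith)
    have h2 := min_le_right c₁ c₂
    have h3 : (2 * (-(ε / 4)) + (-(ε / 4)) ^ 2) / 2 * q = -((ε / 2 - ε ^ 2 / 16) / 2 * q) := by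
      ring
    rw [← sub_eq_add_neg]
    linarith

namespace UnitPair

theorem ne_zero_of_mem {E : Type*} [NormedAddCommGroup E] (P : UnitPair E) {x : E}
    (hx : x ∈ P.points) : x ≠ 0 := by
  rintro rfl
  simpa using P.norm_eq_one 0 hx

variable {E : Type*} [NormedAddCommGroup E] [InnerProductSpace ℝ E]

/-- The logarithmic potential minimised by transformations to isotropic position. -/
noncomputable def potential (P : UnitPair E) (T : E ≃ₗ[ℝ] E) : ℝ :=
  ∑ x ∈ P.points, (Module.finrank ℝ E * P.mass x) * Real.log ‖T x‖ -
    Real.log |LinearMap.det (T : E →ₗ[ℝ] E)|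

theorem sum_transform (P : UnitPair E) (T : E ≃ₗ[ℝ] E) (g : E → ℝ) :
    ∑ y ∈ (P.transform T).points, (P.transform T).mass y * g y =
      ∑ x ∈ P.points, P.mass x * g (normalizedImage T x) := by
  classical
  have : (P.transform T).points = P.points.image (normalizedImage T) := by
    simp only [transform]
  rw [this, Finset.sum_image (P.normalizedImage_injOn T)]
  exact Finset.sum_congr rfl fun x hx => by rw [P.transform_mass_normalizedImage T hx]

theorem sum_le_massIn (P : UnitPair E) {S : Finset E} (hS : S ⊆ P.points) {W : Submodule ℝ E}
    (hSW : (S : Set E) ⊆ W) : ∑ x ∈ S, P.mass x ≤ P.massIn W := by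
  classical
  refine Finset.sum_le_sum_of_subset_of_nonneg (fun x hx => ?_) fun x hx _ =>
    P.mass_nonneg x (Finset.mem_filter.mp hx).1
  exact Finset.mem_filter.mpr ⟨hS hx, hSW hx⟩

/-- If no subspace is overloaded, then the potential is bounded below. -/
theorem bddBelow_potential [FiniteDimensional ℝ E] (P : UnitPair E)
    (hP : ∀ W : Submodule ℝ E, Module.finrank ℝ E * P.massIn W ≤ Module.finrank ℝ W) :
    BddBelow (Set.range P.potential) := by
  classical
  have hC : ∀ B : Finset E, ∃ C : ℝ, LinearIndepOn ℝ id (B : Set E) →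
      Submodule.span ℝ (B : Set E) = ⊤ → ∀ T : E ≃ₗ[ℝ] E,
      Real.log |LinearMap.det (T : E →ₗ[ℝ] E)| ≤ C + ∑ x ∈ B, Real.log ‖T x‖ := by
    intro B
    by_cases h : LinearIndepOn ℝ id (B : Set E) ∧ Submodule.span ℝ (B : Set E) = ⊤
    · obtain ⟨C, hC⟩ := exists_log_abs_det_le B h.1 h.2
      exact ⟨C, fun _ _ => hC⟩
    · exact ⟨0, fun h1 h2 => absurd ⟨h1, h2⟩ h⟩
  choose C hC using hC
  -- The basis depends on `T`, but there are finitely many candidates, so one constant suffices.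
  obtain ⟨M, hM⟩ := (P.points.powerset.image C).exists_le
  refine ⟨-M, ?_⟩
  rintro _ ⟨T, rfl⟩
  obtain ⟨B, hBX, hind, hspan, hsum⟩ := exists_basis_sum_le P.points (fun x => Real.log ‖T x‖)
    (fun x => Module.finrank ℝ E * P.mass x) (fun S hS => by
      rw [← Finset.mul_sum]
      exact (mul_le_mul_of_nonneg_left (P.sum_le_massIn hS Submodule.subset_span)
        (Nat.cast_nonneg _)).trans (hP _)) (by rw [← Finset.mul_sum, P.sum_mass, mul_one])
  have h1 := hC B hind hspan T
  have h2 := hM (C B) (Finset.mem_image_of_mem C (Finset.mem_powerset.mpr hBX))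
  rw [potential]
  linarith

/-- The effect of a stretch on the potential. -/
theorem exists_potential_le [FiniteDimensional ℝ E] (P : UnitPair E) (T : E ≃ₗ[ℝ] E) (v : E)
    (hv : ‖v‖ = 1) (a : ℝ) (ha : -1 < a) :
    ∃ T' : E ≃ₗ[ℝ] E, P.potential T' ≤ P.potential T +
      ((2 * a + a ^ 2) / 2 * (Module.finrank ℝ E *
        ∑ x ∈ P.points, P.mass x * inner ℝ (normalizedImage T x) v ^ 2) - Real.log (1 + a)) := by
  obtain ⟨A, hdet, hA⟩ := exists_stretch v hv a ha
  refine ⟨T.trans A, ?_⟩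
  have hlog : ∀ x ∈ P.points, Real.log ‖A (T x)‖ ≤ Real.log ‖T x‖ +
      (2 * a + a ^ 2) / 2 * inner ℝ (normalizedImage T x) v ^ 2 := by
    intro x hx
    have hTx : ‖T x‖ ≠ 0 := by simpa using P.ne_zero_of_mem hx
    have hATx : ‖A (T x)‖ ≠ 0 := by simpa using P.ne_zero_of_mem hx
    -- Squaring the ratio makes its excess over 1 exactly a multiple of the squared inner product.
    have h := Real.log_le_sub_one_of_pos
      (show 0 < (‖A (T x)‖ / ‖T x‖) ^ 2 by positivity)
    have hq : (‖A (T x)‖ / ‖T x‖) ^ 2 - 1 =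
        (2 * a + a ^ 2) * inner ℝ (normalizedImage T x) v ^ 2 := by
      rw [div_pow, hA, normalizedImage, inner_smul_left]
      simp only [map_inv₀, conj_trivial]
      field_simp
      ring
    rw [hq, Real.log_pow, Real.log_div hATx hTx] at h
    push_cast at h
    linarith
  have hsum : ∑ x ∈ P.points, (Module.finrank ℝ E * P.mass x) * Real.log ‖A (T x)‖ ≤
      ∑ x ∈ P.points, (Module.finrank ℝ E * P.mass x) * Real.log ‖T x‖ +
        (2 * a + a ^ 2) / 2 * (Module.finrank ℝ E *
          ∑ x ∈ P.points, P.mass x * inner ℝ (normalizedImage T x) v ^ 2) := by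
    rw [Finset.mul_sum, Finset.mul_sum, ← Finset.sum_add_distrib]
    refine Finset.sum_le_sum fun x hx => ?_
    have := mul_le_mul_of_nonneg_left (hlog x hx)
      (mul_nonneg (Nat.cast_nonneg (α := ℝ) (Module.finrank ℝ E)) (P.mass_nonneg x hx))
    linarith
  have hd : Real.log |LinearMap.det (T.trans A : E →ₗ[ℝ] E)| =
      Real.log (1 + a) + Real.log |LinearMap.det (T : E →ₗ[ℝ] E)| := by
    rw [LinearEquiv.coe_trans, LinearMap.det_comp, hdet, abs_mul,
      abs_of_pos (show 0 < 1 + a by linarith), Real.log_mul (by linarith)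
        (abs_ne_zero.mpr (LinearEquiv.isUnit_det' T).ne_zero)]
  simp only [potential, LinearEquiv.trans_apply, hd]
  linarith

/-- If no subspace is overloaded, then the pair can be brought arbitrarily close to isotropic
position. -/
theorem exists_isIsotropic_transform [FiniteDimensional ℝ E] (P : UnitPair E)
    (hE : 0 < Module.finrank ℝ E)
    (hP : ∀ W : Submodule ℝ E, Module.finrank ℝ E * P.massIn W ≤ Module.finrank ℝ W)
    (ε : ℝ) (hε : 0 < ε) : ∃ T : E ≃ₗ[ℝ] E, (P.transform T).IsIsotropic ε := by
  have hk : (0 : ℝ) < Module.finrank ℝ E := Nat.cast_pos.mpr hE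
  obtain ⟨δ, hδ0, hδ1, hδε⟩ : ∃ δ : ℝ, 0 < δ ∧ δ < 1 ∧ δ ≤ ε :=
    ⟨min ε (1 / 2), by positivity, (min_le_right _ _).trans_lt (by norm_num), min_le_left _ _⟩
  obtain ⟨c, hc, hgain⟩ := exists_stretch_gain δ hδ0 hδ1
  obtain ⟨_, ⟨T, rfl⟩, hT⟩ := Real.lt_sInf_add_pos (Set.range_nonempty P.potential) hc
  refine ⟨T, fun v hv => ?_⟩
  have hv0 : ‖v‖ ≠ 0 := norm_ne_zero_iff.mpr hv
  have hu : ‖‖v‖⁻¹ • v‖ = 1 := by rw [norm_smul, norm_inv, norm_norm, inv_mul_cancel₀ hv0]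
  obtain ⟨q, hq⟩ : ∃ q, q = ∑ x ∈ P.points,
      P.mass x * inner ℝ (normalizedImage T x) (‖v‖⁻¹ • v) ^ 2 := ⟨_, rfl⟩
  have hsum : ∑ x ∈ (P.transform T).points,
      (P.transform T).mass x * (inner ℝ x v ^ 2 / ‖v‖ ^ 2) = q := by
    rw [P.sum_transform T fun y => inner ℝ y v ^ 2 / ‖v‖ ^ 2, hq]
    refine Finset.sum_congr rfl fun x _ => ?_
    rw [inner_smul_right, mul_pow, inv_pow]
    ring
  have hmid : ¬ (Module.finrank ℝ E * q < 1 - δ ∨ 1 + δ < Module.finrank ℝ E * q) := by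
    intro h
    obtain ⟨a, ha, hle⟩ := hgain _ h
    obtain ⟨T', hT'⟩ := P.exists_potential_le T _ hu a ha
    rw [← hq] at hT'
    have := csInf_le (P.bddBelow_potential hP) (Set.mem_range_self T')
    linarith
  rw [not_or, not_lt, not_lt] at hmid
  rw [hsum, mul_one_div, mul_one_div, div_le_iff₀ hk, le_div_iff₀ hk]
  constructor <;> linarith [hmid.1, hmid.2]

theorem massIn_restrict (P : UnitPair E) (V : Submodule ℝ E) (hV : 0 < P.massIn V)
    (W : Submodule ℝ V) :
    (P.restrict V hV).massIn W = P.massIn (W.map V.subtype) / P.massIn V := by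
  classical
  have h : ((P.restrict V hV).points.filter (· ∈ W)).map (Function.Embedding.subtype _) =
      P.points.filter (· ∈ W.map V.subtype) := by
    ext x
    simp only [restrict, Finset.mem_map, Finset.mem_filter, Finset.mem_subtype,
      Function.Embedding.subtype_apply, Submodule.mem_map, Submodule.subtype_apply]
    constructor
    · rintro ⟨y, ⟨hy, hyW⟩, rfl⟩
      exact ⟨hy, y, hyW, rfl⟩
    · rintro ⟨hx, y, hyW, rfl⟩
      exact ⟨y, ⟨hx, hyW⟩, rfl⟩
  have h2 : P.massIn (W.map V.subtype) =
      ∑ x ∈ P.points.filter (· ∈ W.map V.subtype), P.mass x := by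
    unfold massIn
    congr
  rw [h2, ← h, Finset.sum_map, Finset.sum_div]
  unfold massIn
  refine Finset.sum_congr (by congr) fun x _ => rfl

theorem massIn_bot (P : UnitPair E) : P.massIn ⊥ = 0 := by
  classical
  refine Finset.sum_eq_zero fun x hx => ?_
  obtain ⟨hx, h0⟩ := Finset.mem_filter.mp hx
  exact absurd ((Submodule.mem_bot ℝ).mp h0) (P.ne_zero_of_mem hx)

theorem massIn_top (P : UnitPair E) : P.massIn ⊤ = 1 := by
  simp [massIn, P.sum_mass]

theorem massIn_mono (P : UnitPair E) {V W : Submodule ℝ E} (h : V ≤ W) :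
    P.massIn V ≤ P.massIn W := by
  classical
  exact P.sum_le_massIn (Finset.filter_subset _ _) fun x hx =>
    h (Finset.mem_filter.mp (Finset.mem_coe.mp hx)).2

end UnitPair

theorem mainTheorem6 (d : ℕ) (P : UnitPair (EuclideanSpace ℝ (Fin d))) :
    ∃ k : ℕ, 1 ≤ k ∧ k ≤ d ∧
      ∃ V : Submodule ℝ (EuclideanSpace ℝ (Fin d)),
        Module.finrank ℝ V = k ∧
        (k : ℝ) / (d : ℝ) ≤ P.massIn V ∧
        ∃ hV : 0 < P.massIn V, ∀ ε : ℝ, 0 < ε →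
          ∃ T : V ≃ₗ[ℝ] V, ((P.restrict V hV).transform T).IsIsotropic ε := by
  classical
  have hd : 0 < d := by
    rcases Nat.eq_zero_or_pos d with rfl | h
    · have h1 := P.massIn_top
      rw [Subsingleton.elim (⊤ : Submodule ℝ (EuclideanSpace ℝ (Fin 0))) ⊥, P.massIn_bot] at h1
      exact absurd h1 zero_ne_one
    · exact h
  have hdR : (0 : ℝ) < d := Nat.cast_pos.mpr hd
  have hex : ∃ k : ℕ, 1 ≤ k ∧ ∃ V : Submodule ℝ (EuclideanSpace ℝ (Fin d)),
      Module.finrank ℝ V = k ∧ (k : ℝ) / (d : ℝ) ≤ P.massIn V :=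
    ⟨d, hd, ⊤, by simp, by rw [P.massIn_top, div_self hdR.ne']⟩
  obtain ⟨hk1, V, hVk, hmass⟩ := Nat.find_spec hex
  have hmin := fun k (hk : k < Nat.find hex) => Nat.find_min hex hk
  generalize Nat.find hex = k at hk1 hVk hmass hmin
  have hkR : (0 : ℝ) < k := Nat.cast_pos.mpr hk1
  have hV : 0 < P.massIn V := (div_pos hkR hdR).trans_le hmass
  refine ⟨k, hk1, ?_, V, hVk, hmass, hV, ?_⟩
  · rw [← hVk]
    simpa using Submodule.finrank_le V
  refine UnitPair.exists_isIsotropic_transform _ (by omega) fun W => ?_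
  rw [P.massIn_restrict V hV W, hVk, ← mul_div_assoc, div_le_iff₀ hV]
  have hrank : Module.finrank ℝ (W.map V.subtype) = Module.finrank ℝ W :=
    (Submodule.equivMapOfInjective V.subtype V.injective_subtype W).finrank_eq.symm
  -- Minimality of `k` only speaks of positive dimensions, so the zero subspace is treated apart.
  rcases Nat.eq_zero_or_pos (Module.finrank ℝ W) with h0 | h0
  · rw [Submodule.finrank_eq_zero] at h0
    rw [h0, Submodule.map_bot, P.massIn_bot, mul_zero]
    exact mul_nonneg (Nat.cast_nonneg _) hV.le
  rcases (Nat.lt_or_ge (Module.finrank ℝ W) k) with hlt | hge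
  · have hlt' : P.massIn (W.map V.subtype) < Module.finrank ℝ W / d := by
      by_contra! h
      exact hmin _ hlt ⟨h0, _, hrank, h⟩
    calc (k : ℝ) * P.massIn (W.map V.subtype) ≤ k * (Module.finrank ℝ W / d) :=
          mul_le_mul_of_nonneg_left hlt'.le hkR.le
      _ = Module.finrank ℝ W * (k / d) := by ring
      _ ≤ Module.finrank ℝ W * P.massIn V :=
          mul_le_mul_of_nonneg_left hmass (Nat.cast_nonneg _)
  · exact mul_le_mul (Nat.cast_le.mpr hge) (P.massIn_mono (Submodule.map_subtype_le V W))
      (Finset.sum_nonneg fun x hx => P.mass_nonneg x (Finset.mem_filter.mp hx).1)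
      (Nat.cast_nonneg _)
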